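/- Let $G$ be a five dimensional Lie group with Lie algebra $\mathfrak g$, let $\tilde a$ be a left invariant Riemannian metric on $G$, and let $E_1,\dots,E_5$ be a basis of $\mathfrak g$ that is orthonormal for the inner product induced by $\tilde a$. For a left invariant vector field $X$ with $\tilde a(X,X)<1$ let $$F(x,y)=\sqrt{\tilde a(y,y)}+\tilde a(X(x),y)$$ be the associated left invariant Randers metric. Its S-curvature $S(x,y)$, $y\neq 0$, is the derivative at $t=0$ of $\tau(\gamma(t),\dot\gamma(t))$, where $\gamma$ is the geodesic of $F$ with $\gamma(0)=x$, $\dot\gamma(0)=y$, where $\tau=\ln\big(\sqrt{\det(g_{ij}(x,y))}/\sigma(x)\big)$ is the distortion, $g_{ij}=\frac12\frac{\partial^2F^2}{\partial y^i\partial y^j}$, and $\sigma(x)\,dx^1\wedge\dots\wedge dx^n$ is the Busemann-Hausdorff volume form of $F$. Let $Y=y_1E_1+\dots+y_5E_5\neq0$, let $\lambda_1,\lambda_2,\lambda_3\in\mathbb R$, and write $S(Y)$ and $F(Y)$ for the values at the left invariant vector field $Y$, which do not depend on the point of $G$. Brackets $[E_i,E_j]$, $i<j$, that are not listed are zero. In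 each of the following cases the stated formula holds for every $X$ of the stated form with $\tilde a(X,X)<1$, in particular for every such $X$ for which $F$ is a non-Riemannian Randers metric of Douglas type. 1. ($\mathfrak l_{5,7}$) If $[E_1,E_2]=aE_3+bE_4+cE_5$, $[E_1,E_3]=dE_4+fE_5$, $[E_1,E_4]=gE_5$, with $a,d,g>0$ and either $b>0$, or $b=0$ and $f\ge0$, and $X=\lambda_1E_1+\lambda_2E_2$, then $$S(Y)=3\,\frac{(y_1\lambda_2-y_2\lambda_1)(ay_3+by_4+cy_5)-\lambda_1y_3(dy_4+fy_5)-\lambda_1gy_4y_5}{F(Y)}.$$ 2. ($\mathfrak l_{5,6}$) If $[E_1,E_2]=aE_3+bE_4+cE_5$, $[E_1,E_3]=dE_4+fE_5$, $[E_1,E_4]=gE_5$, $[E_2,E_3]=hE_5$, with $a,d,g,h>0$ and either $b>0$, or $b=0$ and $f\ge0$, and $X=\lambda_1E_1+\lambda_2E_2$, then $$S(Y)=3\,\frac{(y_1\lambda_2-y_2\lambda_1)(ay_3+by_4+cy_5)-\lambda_1y_3(dy_4+fy_5)-y_5(h\lambda_2y_3+g\lambda_1y_4)}{F(Y)}.$$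 3. ($\mathfrak l_{5,5}$) If $[E_1,E_2]=aE_4+bE_5$, $[E_1,E_3]=cE_5$, $[E_1,E_4]=dE_5$, $[E_2,E_3]=eE_5$, with $a,d,e>0$ and $b,c\ge0$, and $X=\lambda_1E_1+\lambda_2E_2+\lambda_3E_3$, then $$S(Y)=3\,\frac{(y_1\lambda_2-y_2\lambda_1)(ay_4+by_5)+y_5\lambda_3(cy_1+ey_2)-y_5\lambda_1(cy_3+dy_4)-e\lambda_2y_3y_5}{F(Y)}.$$ 4. ($\mathfrak l_{5,9}$) If $[E_1,E_2]=kE_3+lE_4+mE_5$, $[E_1,E_3]=pE_4$, $[E_2,E_3]=qE_5$, with either $k>0$, $q>p>0$ and $l,m\ge0$, or $k,p>0$, $l\ge0$, $m=0$ and $q=p$, and $X=\lambda_1E_1+\lambda_2E_2$, then $$S(Y)=3\,\frac{(y_1\lambda_2-y_2\lambda_1)(ky_3+ly_4+my_5)-y_3(p\lambda_1y_4+q\lambda_2y_5)}{F(Y)}.$$ -/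

import Mathlib

open scoped Manifold ContDiff Bundle

noncomputable section

/-! ## Finsler functions in coordinates

A Finsler function on an open subset of `ℝⁿ` is written `L u v`, where `u` is the position
`(x¹, …, xⁿ)` and `v` is the velocity `(y¹, …, yⁿ)`. -/

namespace Finsler

/-- The `i`-th partial derivative of `f : ℝⁿ → ℝ`. -/
def partialDeriv {n : ℕ} (i : Fin n) (f : EuclideanSpace ℝ (Fin n) → ℝ)
    (u : EuclideanSpace ℝ (Fin n)) : ℝ :=
  fderiv ℝ f u (EuclideanSpace.single i 1)

/-- The fundamental tensor `g_ij = (1/2) ∂²L² / ∂yⁱ∂yʲ`. -/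
def fundamentalTensor {n : ℕ}
    (L : EuclideanSpace ℝ (Fin n) → EuclideanSpace ℝ (Fin n) → ℝ)
    (u v : EuclideanSpace ℝ (Fin n)) : Matrix (Fin n) (Fin n) ℝ :=
  Matrix.of fun i j =>
    (1 / 2) * partialDeriv i (fun w => partialDeriv j (fun z => L u z ^ 2) w) v

/-- The spray coefficients
`Gⁱ = (1/4) g^{il} ([L²]_{x^m y^l} y^m - [L²]_{x^l})`, as a vector of `ℝⁿ`. -/
def spray {n : ℕ}
    (L : EuclideanSpace ℝ (Fin n) → EuclideanSpace ℝ (Fin n) → ℝ)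
    (u v : EuclideanSpace ℝ (Fin n)) : EuclideanSpace ℝ (Fin n) :=
  WithLp.toLp 2 fun i =>
    (1 / 4) * ∑ l, (fundamentalTensor L u v)⁻¹ i l *
      ((∑ m, partialDeriv m (fun p => partialDeriv l (fun z => L p z ^ 2) v) u * v m)
        - partialDeriv l (fun p => L p v ^ 2) u)

/-- The density `σ` of the Busemann-Hausdorff volume form `σ(x) dx¹ ∧ ⋯ ∧ dxⁿ`: the volume of
the Euclidean unit ball divided by the volume of the unit ball of the norm `L u`. -/
def busemannHausdorff {n : ℕ}
    (L : EuclideanSpace ℝ (Fin n) → EuclideanSpace ℝ (Fin n) → ℝ)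
    (u : EuclideanSpace ℝ (Fin n)) : ℝ :=
  MeasureTheory.volume.real (Metric.ball (0 : EuclideanSpace ℝ (Fin n)) 1) /
    MeasureTheory.volume.real {v : EuclideanSpace ℝ (Fin n) | L u v < 1}

/-- The distortion `τ = log (√(det g_ij) / σ)`, a function on the (slit) tangent bundle. -/
def distortion {n : ℕ}
    (L : EuclideanSpace ℝ (Fin n) → EuclideanSpace ℝ (Fin n) → ℝ)
    (p : EuclideanSpace ℝ (Fin n) × EuclideanSpace ℝ (Fin n)) : ℝ :=
  Real.log (Real.sqrt (fundamentalTensor L p.1 p.2).det / busemannHausdorff L p.1)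

/-- The rate of change at `(u, v)` of the distortion along geodesics: its derivative in the
direction of the geodesic spray `yⁱ ∂/∂xⁱ - 2 Gⁱ ∂/∂yⁱ`, whose integral curves are the curves
`t ↦ (c t, c' t)` with `c` a geodesic, `c'' + 2 G (c, c') = 0`
(see `hasDerivAt_distortion_geodesic`). -/
def distortionRate {n : ℕ}
    (L : EuclideanSpace ℝ (Fin n) → EuclideanSpace ℝ (Fin n) → ℝ)
    (u v : EuclideanSpace ℝ (Fin n)) : ℝ :=
  fderiv ℝ (distortion L) (u, v) (v, (-2 : ℝ) • spray L u v)

/-- Along a geodesic `c` with velocity `c'`, the derivative of the distortion is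
`distortionRate`. -/
theorem hasDerivAt_distortion_geodesic {n : ℕ}
    {L : EuclideanSpace ℝ (Fin n) → EuclideanSpace ℝ (Fin n) → ℝ}
    {c c' : ℝ → EuclideanSpace ℝ (Fin n)} {t : ℝ}
    (hc : HasDerivAt c (c' t) t)
    (hc' : HasDerivAt c' ((-2 : ℝ) • spray L (c t) (c' t)) t)
    (hL : DifferentiableAt ℝ (distortion L) (c t, c' t)) :
    HasDerivAt (fun s => distortion L (c s, c' s)) (distortionRate L (c t) (c' t)) t :=
  HasFDerivAt.comp_hasDerivAt_of_eq t hL.hasFDerivAt (hc.prodMk hc') rfl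

/-! ## The S-curvature of a Finsler function on a manifold -/

/-- The expression of `F : TM → ℝ` in a chart `φ`. -/
def inChart {n : ℕ} {M : Type*} [TopologicalSpace M]
    [ChartedSpace (EuclideanSpace ℝ (Fin n)) M]
    (F : (x : M) → TangentSpace 𝓘(ℝ, EuclideanSpace ℝ (Fin n)) x → ℝ)
    (φ : OpenPartialHomeomorph M (EuclideanSpace ℝ (Fin n)))
    (u v : EuclideanSpace ℝ (Fin n)) : ℝ :=
  F (φ.symm u) (mfderiv 𝓘(ℝ, EuclideanSpace ℝ (Fin n)) 𝓘(ℝ, EuclideanSpace ℝ (Fin n)) φ.symm u v)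

/-- `HasSCurvature F x y s` says that the S-curvature `S(x, y)` of `F` (with respect to the
Busemann-Hausdorff volume) exists and equals `s`: in every smooth chart of `M` around `x` the
distortion is differentiable at `(x, y)`, and its rate of change along the geodesic through `x`
with velocity `y` is `s`. -/
def HasSCurvature {n : ℕ} {M : Type*} [TopologicalSpace M]
    [ChartedSpace (EuclideanSpace ℝ (Fin n)) M]
    (F : (x : M) → TangentSpace 𝓘(ℝ, EuclideanSpace ℝ (Fin n)) x → ℝ)
    (x : M) (y : TangentSpace 𝓘(ℝ, EuclideanSpace ℝ (Fin n)) x) (s : ℝ) : Prop :=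
  ∀ φ ∈ IsManifold.maximalAtlas 𝓘(ℝ, EuclideanSpace ℝ (Fin n)) ∞ M, x ∈ φ.source →
    let v : EuclideanSpace ℝ (Fin n) :=
      mfderiv 𝓘(ℝ, EuclideanSpace ℝ (Fin n)) 𝓘(ℝ, EuclideanSpace ℝ (Fin n)) φ x y
    DifferentiableAt ℝ (distortion (inChart F φ)) (φ x, v) ∧
      distortionRate (inChart F φ) (φ x) v = s

/-! ## Left invariant Riemannian and Randers metrics on a Lie group -/

/-- Smooth Riemannian metrics on a manifold modelled on `ℝⁿ`. -/
abbrev RiemannianMetricOn (n : ℕ) (M : Type*) [TopologicalSpace M]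
    [ChartedSpace (EuclideanSpace ℝ (Fin n)) M]
    [IsManifold 𝓘(ℝ, EuclideanSpace ℝ (Fin n)) ∞ M] :=
  Bundle.ContMDiffRiemannianMetric 𝓘(ℝ, EuclideanSpace ℝ (Fin n)) ∞
    (EuclideanSpace ℝ (Fin n)) (fun x : M => TangentSpace 𝓘(ℝ, EuclideanSpace ℝ (Fin n)) x)

/-- The Riemannian metric `a` is left invariant: every left translation is an isometry. -/
def IsLeftInvariant {n : ℕ} {G : Type*} [TopologicalSpace G]
    [ChartedSpace (EuclideanSpace ℝ (Fin n)) G]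
    [IsManifold 𝓘(ℝ, EuclideanSpace ℝ (Fin n)) ∞ G] [Group G]
    (a : RiemannianMetricOn n G) : Prop :=
  ∀ (h x : G) (v w : TangentSpace 𝓘(ℝ, EuclideanSpace ℝ (Fin n)) x),
    a.inner (h * x)
      (mfderiv 𝓘(ℝ, EuclideanSpace ℝ (Fin n)) 𝓘(ℝ, EuclideanSpace ℝ (Fin n)) (h * ·) x v)
      (mfderiv 𝓘(ℝ, EuclideanSpace ℝ (Fin n)) 𝓘(ℝ, EuclideanSpace ℝ (Fin n)) (h * ·) x w)
      = a.inner x v w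

/-- The function `F(x, y) = √(a(y, y)) + a(X(x), y)` defined by a Riemannian metric `a` and the
left invariant vector field with value `X` at the identity. -/
def randers {n : ℕ} {G : Type*} [TopologicalSpace G]
    [ChartedSpace (EuclideanSpace ℝ (Fin n)) G]
    [IsManifold 𝓘(ℝ, EuclideanSpace ℝ (Fin n)) ∞ G] [Group G]
    (a : RiemannianMetricOn n G)
    (X : GroupLieAlgebra 𝓘(ℝ, EuclideanSpace ℝ (Fin n)) G)
    (x : G) (y : TangentSpace 𝓘(ℝ, EuclideanSpace ℝ (Fin n)) x) : ℝ :=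
  Real.sqrt (a.inner x y y) + a.inner x (mulInvariantVectorField X x) y

end Finsler

/-! ## Five dimensional nilpotent Lie algebras of nilpotency class greater than two

The basis `E₁, …, E₅` is indexed by `Fin 5`, so that `E 0` is `E₁` and `E 4` is `E₅`. -/

/-- `E` satisfies the bracket relations of `𝔩₅,₇`. -/
structure IsL57 {L : Type*} [AddCommGroup L] [Module ℝ L] [Bracket L L]
    (E : Fin 5 → L) (a b c d f g : ℝ) : Prop where
  a_pos : 0 < a
  d_pos : 0 < d
  g_pos : 0 < g
  sign : 0 < b ∨ (b = 0 ∧ 0 ≤ f)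
  bracket12 : ⁅E 0, E 1⁆ = a • E 2 + b • E 3 + c • E 4
  bracket13 : ⁅E 0, E 2⁆ = d • E 3 + f • E 4
  bracket14 : ⁅E 0, E 3⁆ = g • E 4
  bracket15 : ⁅E 0, E 4⁆ = 0
  bracket23 : ⁅E 1, E 2⁆ = 0
  bracket24 : ⁅E 1, E 3⁆ = 0
  bracket25 : ⁅E 1, E 4⁆ = 0
  bracket34 : ⁅E 2, E 3⁆ = 0
  bracket35 : ⁅E 2, E 4⁆ = 0
  bracket45 : ⁅E 3, E 4⁆ = 0

/-- `E` satisfies the bracket relations of `𝔩₅,₆`. -/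
structure IsL56 {L : Type*} [AddCommGroup L] [Module ℝ L] [Bracket L L]
    (E : Fin 5 → L) (a b c d f g h : ℝ) : Prop where
  a_pos : 0 < a
  d_pos : 0 < d
  g_pos : 0 < g
  h_pos : 0 < h
  sign : 0 < b ∨ (b = 0 ∧ 0 ≤ f)
  bracket12 : ⁅E 0, E 1⁆ = a • E 2 + b • E 3 + c • E 4
  bracket13 : ⁅E 0, E 2⁆ = d • E 3 + f • E 4
  bracket14 : ⁅E 0, E 3⁆ = g • E 4
  bracket15 : ⁅E 0, E 4⁆ = 0
  bracket23 : ⁅E 1, E 2⁆ = h • E 4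
  bracket24 : ⁅E 1, E 3⁆ = 0
  bracket25 : ⁅E 1, E 4⁆ = 0
  bracket34 : ⁅E 2, E 3⁆ = 0
  bracket35 : ⁅E 2, E 4⁆ = 0
  bracket45 : ⁅E 3, E 4⁆ = 0

/-- `E` satisfies the bracket relations of `𝔩₅,₅`. -/
structure IsL55 {L : Type*} [AddCommGroup L] [Module ℝ L] [Bracket L L]
    (E : Fin 5 → L) (a b c d e : ℝ) : Prop where
  a_pos : 0 < a
  d_pos : 0 < d
  e_pos : 0 < e
  b_nonneg : 0 ≤ b
  c_nonneg : 0 ≤ c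
  bracket12 : ⁅E 0, E 1⁆ = a • E 3 + b • E 4
  bracket13 : ⁅E 0, E 2⁆ = c • E 4
  bracket14 : ⁅E 0, E 3⁆ = d • E 4
  bracket15 : ⁅E 0, E 4⁆ = 0
  bracket23 : ⁅E 1, E 2⁆ = e • E 4
  bracket24 : ⁅E 1, E 3⁆ = 0
  bracket25 : ⁅E 1, E 4⁆ = 0
  bracket34 : ⁅E 2, E 3⁆ = 0
  bracket35 : ⁅E 2, E 4⁆ = 0
  bracket45 : ⁅E 3, E 4⁆ = 0

/-- `E` satisfies the bracket relations of `𝔩₅,₉`. -/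
structure IsL59 {L : Type*} [AddCommGroup L] [Module ℝ L] [Bracket L L]
    (E : Fin 5 → L) (k l m p q : ℝ) : Prop where
  sign : (0 < k ∧ 0 < p ∧ p < q ∧ 0 ≤ l ∧ 0 ≤ m) ∨
    (0 < k ∧ 0 < p ∧ 0 ≤ l ∧ m = 0 ∧ q = p)
  bracket12 : ⁅E 0, E 1⁆ = k • E 2 + l • E 3 + m • E 4
  bracket13 : ⁅E 0, E 2⁆ = p • E 3
  bracket14 : ⁅E 0, E 3⁆ = 0
  bracket15 : ⁅E 0, E 4⁆ = 0
  bracket23 : ⁅E 1, E 2⁆ = q • E 4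
  bracket24 : ⁅E 1, E 3⁆ = 0
  bracket25 : ⁅E 1, E 4⁆ = 0
  bracket34 : ⁅E 2, E 3⁆ = 0
  bracket35 : ⁅E 2, E 4⁆ = 0
  bracket45 : ⁅E 3, E 4⁆ = 0

end

/-! In the left invariant orthonormal frame the Randers metric becomes one fixed function `‖c‖ + ⟨p,
c⟩` of the frame components `c` of the velocity. The frame determinant enters `√det g` and the
Busemann-Hausdorff density alike, so it cancels, and the distortion is `(n+1)/2 · log (F/‖c‖)` plus
a constant (`distortion_of_frame`). `F` is constant along geodesics, so only the rate of `log ‖c‖`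
matters. The geodesic equation in the frame (`randersTensor_spray_of_frame`), tested against the
velocity and against `X`, determines that rate as soon as `⟨X, [Y, X]⟩ = 0`, giving `S(Y) = (n+1)/2
· ⟨Y, [Y, X]⟩ / F(Y)` (`distortionRate_of_frame`, `hasSCurvature_randers`). In all four algebras `X`
is orthogonal to the derived algebra, so the condition holds, and what remains is to expand `⟨Y, [Y,
X]⟩`, with `(5+1)/2 = 3`. -/

noncomputable section

namespace Finsler

open Filter Topology

/-! ## The Randers norm of an inner product space -/

section RandersNorm

variable {V : Type*} [NormedAddCommGroup V] [InnerProductSpace ℝ V]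

/-- The function `c ↦ ‖c‖ + ⟨p, c⟩`. -/
def randersNorm (p c : V) : ℝ := ‖c‖ + inner ℝ p c

/-- The derivative of `randersNorm p` at `c ≠ 0`. -/
def randersNormDeriv (p c : V) : V →L[ℝ] ℝ := ‖c‖⁻¹ • innerSL ℝ c + innerSL ℝ p

/-- Half of the second derivative of `(randersNorm p) ^ 2` at `c ≠ 0`. -/
def randersTensor (p c w z : V) : ℝ :=
  randersNormDeriv p c w * randersNormDeriv p c z +
    randersNorm p c * (inner ℝ w z / ‖c‖ - inner ℝ c w * inner ℝ c z / ‖c‖ ^ 3)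

theorem randersNormDeriv_apply (p c z : V) :
    randersNormDeriv p c z = ‖c‖⁻¹ * inner ℝ c z + inner ℝ p z := by
  simp [randersNormDeriv]

theorem randersNorm_pos {p c : V} (hp : ‖p‖ < 1) (hc : c ≠ 0) : 0 < randersNorm p c := by
  have h0 : 0 < ‖c‖ := norm_pos_iff.2 hc
  have h1 := (abs_le.1 (abs_real_inner_le_norm p c)).1
  have h2 : ‖p‖ * ‖c‖ < 1 * ‖c‖ := mul_lt_mul_of_pos_right hp h0
  unfold randersNorm
  linarith

theorem hasFDerivAt_norm_of_ne {c : V} (hc : c ≠ 0) :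
    HasFDerivAt (fun x : V => ‖x‖) (‖c‖⁻¹ • innerSL ℝ c) c := by
  have h0 : ‖c‖ ≠ 0 := norm_ne_zero_iff.2 hc
  have h := (hasStrictFDerivAt_norm_sq c).hasFDerivAt.sqrt (pow_ne_zero 2 h0)
  simp only [Real.sqrt_sq (norm_nonneg _)] at h
  refine h.congr_fderiv ?_
  ext z
  simp
  field_simp

theorem hasFDerivAt_randersNorm (p : V) {c : V} (hc : c ≠ 0) :
    HasFDerivAt (randersNorm p) (randersNormDeriv p c) c :=
  (hasFDerivAt_norm_of_ne hc).add (innerSL ℝ p).hasFDerivAt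

/-- Euler's identity for a function homogeneous of degree one. -/
theorem randersNormDeriv_self (p : V) {c : V} (hc : c ≠ 0) :
    randersNormDeriv p c c = randersNorm p c := by
  have h0 : ‖c‖ ≠ 0 := norm_ne_zero_iff.2 hc
  rw [randersNormDeriv_apply, randersNorm, real_inner_self_eq_norm_sq]
  field_simp

/-- The angular part of the tensor annihilates `c`, leaving only the product of first derivatives.
-/
theorem randersTensor_self (p : V) {c : V} (hc : c ≠ 0) (w : V) :
    randersTensor p c w c = randersNorm p c * randersNormDeriv p c w := by
  have h0 : ‖c‖ ≠ 0 := norm_ne_zero_iff.2 hc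
  rw [randersTensor, randersNormDeriv_self p hc, real_inner_self_eq_norm_sq,
    real_inner_comm w c]
  field_simp
  ring

/-- The bilinear form `randersTensor p c`. -/
def randersForm (p c : V) : V →ₗ[ℝ] V →ₗ[ℝ] ℝ :=
  LinearMap.mk₂ ℝ (randersTensor p c)
    (fun x y z => by
      simp only [randersTensor, inner_add_left, inner_add_right, map_add]
      ring)
    (fun a x z => by
      simp only [randersTensor, real_inner_smul_left, real_inner_smul_right, map_smul, smul_eq_mul]
      ring)
    (fun x y z => by
      simp only [randersTensor, inner_add_right, map_add]
      ring)
    (fun a x z => by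
      simp only [randersTensor, real_inner_smul_right, map_smul, smul_eq_mul]
      ring)

theorem randersForm_apply (p c w z : V) : randersForm p c w z = randersTensor p c w z := rfl

theorem randersTensor_comm (p c w z : V) : randersTensor p c w z = randersTensor p c z w := by
  rw [randersTensor, randersTensor, real_inner_comm]
  ring

variable {W : Type*} [NormedAddCommGroup W] [NormedSpace ℝ W]

theorem hasFDerivAt_randersNorm_sq_comp (p : V) {γ : W → V} {γ' : W →L[ℝ] V} {u : W}
    (hγ : HasFDerivAt γ γ' u) (h0 : γ u ≠ 0) :
    HasFDerivAt (fun x => randersNorm p (γ x) ^ 2)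
      ((2 * randersNorm p (γ u)) • (randersNormDeriv p (γ u)).comp γ') u := by
  refine (((hasFDerivAt_randersNorm p h0).comp u hγ).pow 2).congr_fderiv ?_
  ext w
  simp

/-- Used twice: with `ζ` constant and `γ` linear it gives the fundamental tensor; with both varying
with position it gives the mixed derivatives of `F²` in the spray. -/
theorem exists_hasFDerivAt_randersNormDeriv_comp (p : V) {γ ζ : W → V} {γ' ζ' : W →L[ℝ] V} {u : W}
    (hγ : HasFDerivAt γ γ' u) (hζ : HasFDerivAt ζ ζ' u) (h0 : γ u ≠ 0) :
    ∃ D : W →L[ℝ] ℝ,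
      HasFDerivAt (fun x => 2 * randersNorm p (γ x) * randersNormDeriv p (γ x) (ζ x)) D u ∧
      ∀ w, D w = 2 * randersTensor p (γ u) (γ' w) (ζ u) +
        2 * randersNorm p (γ u) * randersNormDeriv p (γ u) (ζ' w) := by
  have hn : ‖γ u‖ ≠ 0 := norm_ne_zero_iff.2 h0
  have h1 := (hasFDerivAt_randersNorm p h0).comp u hγ
  have h2 := (hasFDerivAt_norm_of_ne h0).comp u hγ
  have h3 := (hasDerivAt_inv hn).comp_hasFDerivAt u h2
  have h4 := (h3.mul (hγ.inner ℝ hζ)).add ((innerSL ℝ p).hasFDerivAt.comp u hζ)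
  have h5 := (h1.const_mul 2).mul h4
  refine ⟨_, h5.congr_of_eventuallyEq (Eventually.of_forall fun x => ?_), fun w => ?_⟩
  · simp [randersNormDeriv_apply]
  · simp only [randersTensor, randersNormDeriv_apply, Function.comp_apply,
      add_apply, smul_apply, ContinuousLinearMap.comp_apply, Pi.add_apply, Pi.mul_apply,
      smul_eq_mul, innerSL_apply_apply, fderivInnerCLM_apply, ContinuousLinearMap.prod_apply]
    rw [real_inner_comm (ζ u) (γ' w)]
    field_simp
    ring

end RandersNorm

/-! ## The fundamental tensor and the distortion in a moving frame -/

section Frame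

variable {n : ℕ} {L : EuclideanSpace ℝ (Fin n) → EuclideanSpace ℝ (Fin n) → ℝ}
  {p u v : EuclideanSpace ℝ (Fin n)}

theorem partialDeriv_randersNorm_sq
    {A : EuclideanSpace ℝ (Fin n) →L[ℝ] EuclideanSpace ℝ (Fin n)}
    (hL : ∀ v, L u v = randersNorm p (A v)) (hv : A v ≠ 0) (j : Fin n) :
    partialDeriv j (fun z => L u z ^ 2) v =
      2 * randersNorm p (A v) * randersNormDeriv p (A v) (A (EuclideanSpace.single j 1)) := by
  simp only [partialDeriv, hL, (hasFDerivAt_randersNorm_sq_comp p A.hasFDerivAt hv).fderiv]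
  simp

theorem fundamentalTensor_apply_of_frame
    {A : EuclideanSpace ℝ (Fin n) →L[ℝ] EuclideanSpace ℝ (Fin n)}
    (hL : ∀ v, L u v = randersNorm p (A v)) (hv : A v ≠ 0) (i j : Fin n) :
    fundamentalTensor L u v i j =
      randersTensor p (A v) (A (EuclideanSpace.single i 1)) (A (EuclideanSpace.single j 1)) := by
  obtain ⟨D, hD, hD'⟩ := exists_hasFDerivAt_randersNormDeriv_comp p (u := v) A.hasFDerivAt
    (hasFDerivAt_const (A (EuclideanSpace.single j 1)) v) hv
  have hev : (fun w => partialDeriv j (fun z => L u z ^ 2) w) =ᶠ[𝓝 v] fun w =>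
      2 * randersNorm p (A w) * randersNormDeriv p (A w) (A (EuclideanSpace.single j 1)) := by
    filter_upwards [A.continuous.continuousAt.eventually_ne hv] with w hw
    exact partialDeriv_randersNorm_sq hL hw j
  simp only [fundamentalTensor, Matrix.of_apply]
  rw [partialDeriv, hev.fderiv_eq, hD.fderiv, hD']
  simp

/-- The matrix of `randersTensor p c` in the standard basis. -/
def randersMatrix (p c : EuclideanSpace ℝ (Fin n)) : Matrix (Fin n) (Fin n) ℝ :=
  Matrix.of fun i j =>
    randersTensor p c (EuclideanSpace.single i 1) (EuclideanSpace.single j 1)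

/-- The matrix is `r (1 - a aᵀ + r⁻¹ l lᵀ)` with `r = F/‖c‖`, a rank two perturbation, so the
identity `det (1 + AB) = det (1 + BA)` reduces it to a 2 × 2 determinant. -/
theorem det_randersMatrix {c : EuclideanSpace ℝ (Fin n)} (hp : ‖p‖ < 1) (hc : c ≠ 0) :
    (randersMatrix p c).det = (randersNorm p c / ‖c‖) ^ (n + 1) := by
  have h0 : ‖c‖ ≠ 0 := norm_ne_zero_iff.2 hc
  have hF : randersNorm p c ≠ 0 := (randersNorm_pos hp hc).ne'
  set r := randersNorm p c / ‖c‖ with hr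
  have hr0 : r ≠ 0 := div_ne_zero hF h0
  let a : Fin n → ℝ := fun i => c i / ‖c‖
  let l : Fin n → ℝ := fun i => c i / ‖c‖ + p i
  let A : Matrix (Fin n) (Fin 2) ℝ := Matrix.of fun i => ![a i, l i]
  let B : Matrix (Fin 2) (Fin n) ℝ := Matrix.of ![fun j => - a j, fun j => r⁻¹ * l j]
  have hK : randersMatrix p c = r • (1 + A * B) := by
    ext i j
    have hs : inner ℝ (EuclideanSpace.single i (1 : ℝ)) (EuclideanSpace.single j (1 : ℝ)) =
        (1 : Matrix (Fin n) (Fin n) ℝ) i j := by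
      rw [EuclideanSpace.inner_single_right]
      simp [Matrix.one_apply, eq_comm]
    simp only [randersMatrix, Matrix.of_apply, randersTensor]
    rw [hs]
    simp only [randersNormDeriv_apply,
      EuclideanSpace.inner_single_right, Matrix.smul_apply, Matrix.add_apply, Matrix.mul_apply,
      Fin.sum_univ_two, A, B, a, l, smul_eq_mul, hr]
    simp
    field_simp
    ring
  have haa : ∑ i, a i * a i = 1 := by
    have h := EuclideanSpace.real_norm_sq_eq c
    simp only [a, ← sq, div_pow, ← Finset.sum_div]
    rw [← h]
    field_simp
  have hal : ∑ i, a i * l i = r := by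
    have h : inner ℝ p c = ∑ i, p i * c i := by
      simp [PiLp.inner_apply, mul_comm]
    have : ∑ i, a i * l i = ∑ i, a i * a i + (∑ i, p i * c i) / ‖c‖ := by
      rw [Finset.sum_div, ← Finset.sum_add_distrib]
      refine Finset.sum_congr rfl fun i _ => ?_
      simp only [a, l]
      ring
    rw [this, haa, hr, randersNorm, h]
    field_simp
  rw [hK, Matrix.det_smul, Matrix.det_one_add_mul_comm, Matrix.det_fin_two]
  -- The upper left entry of `1 + BA` is zero, so the entry involving `∑ l i ^ 2` drops out and the
  -- small determinant is `r`.
  have e00 : (B * A) 0 0 = -1 := by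
    simp [Matrix.mul_apply, A, B, haa]
  have e01 : (B * A) 0 1 = - r := by
    simp [Matrix.mul_apply, A, B, hal]
  have e10 : (B * A) 1 0 = 1 := by
    have : ∑ i, r⁻¹ * l i * a i = r⁻¹ * ∑ i, a i * l i := by
      rw [Finset.mul_sum]
      exact Finset.sum_congr rfl fun i _ => by ring
    simp [Matrix.mul_apply, A, B, this, hal, hr0]
  simp [Matrix.add_apply, e00, e01, e10]
  ring

theorem det_fundamentalTensor_of_frame
    {A : EuclideanSpace ℝ (Fin n) →L[ℝ] EuclideanSpace ℝ (Fin n)}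
    (hp : ‖p‖ < 1) (hL : ∀ v, L u v = randersNorm p (A v)) (hv : A v ≠ 0) :
    (fundamentalTensor L u v).det =
      LinearMap.det (A : EuclideanSpace ℝ (Fin n) →ₗ[ℝ] EuclideanSpace ℝ (Fin n)) ^ 2 *
        (randersNorm p (A v) / ‖A v‖) ^ (n + 1) := by
  let b := (EuclideanSpace.basisFun (Fin n) ℝ).toBasis
  let M := LinearMap.toMatrix b b
    (A : EuclideanSpace ℝ (Fin n) →ₗ[ℝ] EuclideanSpace ℝ (Fin n))
  have hA : ∀ i, A (EuclideanSpace.single i 1) = ∑ k, M k i • EuclideanSpace.single k (1 : ℝ) := by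
    intro i
    have := b.sum_repr (A (EuclideanSpace.single i 1))
    rw [← this]
    refine Finset.sum_congr rfl fun k _ => ?_
    simp [M, b, LinearMap.toMatrix_apply]
  have hg : fundamentalTensor L u v = M.transpose * randersMatrix p (A v) * M := by
    ext i j
    rw [fundamentalTensor_apply_of_frame hL hv]
    rw [← randersForm_apply, hA i, hA j]
    simp only [map_sum, map_smul, LinearMap.sum_apply, LinearMap.smul_apply, smul_eq_mul,
      randersForm_apply, Matrix.mul_apply, Matrix.transpose_apply, randersMatrix, Matrix.of_apply,
      Finset.sum_mul, Finset.mul_sum]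
    refine Finset.sum_congr rfl fun k _ => Finset.sum_congr rfl fun m _ => ?_
    ring
  rw [hg, Matrix.det_mul, Matrix.det_mul, Matrix.det_transpose, det_randersMatrix hp hv,
    LinearMap.det_toMatrix]
  ring

/-- The unit ball lies between two Euclidean balls, so its volume is neither zero nor infinite. -/
theorem volume_real_randersNorm_ball_pos (hp : ‖p‖ < 1) :
    0 < MeasureTheory.volume.real {c : EuclideanSpace ℝ (Fin n) | randersNorm p c < 1} := by
  have hsub : {c : EuclideanSpace ℝ (Fin n) | randersNorm p c < 1} ⊆
      Metric.ball 0 (1 / (1 - ‖p‖)) := by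
    intro c hc
    have h1 := (abs_le.1 (abs_real_inner_le_norm p c)).1
    have h2 : ‖c‖ + inner ℝ p c < 1 := hc
    rw [mem_ball_zero_iff, lt_div_iff₀ (by linarith)]
    linarith
  have hsup : Metric.ball (0 : EuclideanSpace ℝ (Fin n)) (1 / 2) ⊆
      {c | randersNorm p c < 1} := by
    intro c hc
    rw [mem_ball_zero_iff] at hc
    have h1 := (abs_le.1 (abs_real_inner_le_norm p c)).2
    have h2 : ‖p‖ * ‖c‖ ≤ 1 * ‖c‖ := mul_le_mul_of_nonneg_right hp.le (norm_nonneg c)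
    change ‖c‖ + inner ℝ p c < 1
    linarith
  refine ENNReal.toReal_pos ?_ ?_
  · exact ((Metric.measure_ball_pos MeasureTheory.volume _ (by norm_num)).trans_le
      (MeasureTheory.measure_mono hsup)).ne'
  · exact ((MeasureTheory.measure_mono hsub).trans_lt
      MeasureTheory.measure_ball_lt_top).ne

/-- `√det g` contributes `|det A|` and the volume of the unit ball `|det A|⁻¹`, so the distortion
depends on the point only through `A v`. -/
theorem distortion_of_frame
    {A : EuclideanSpace ℝ (Fin n) →L[ℝ] EuclideanSpace ℝ (Fin n)}
    (hA : Function.Injective A)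
    (hp : ‖p‖ < 1) (hL : ∀ v, L u v = randersNorm p (A v)) (hv : A v ≠ 0) :
    distortion L (u, v) =
      (n + 1) / 2 * (Real.log (randersNorm p (A v)) - Real.log ‖A v‖) +
        Real.log (MeasureTheory.volume.real {c : EuclideanSpace ℝ (Fin n) | randersNorm p c < 1} /
          MeasureTheory.volume.real (Metric.ball (0 : EuclideanSpace ℝ (Fin n)) 1)) := by
  have hdet : LinearMap.det
      (A : EuclideanSpace ℝ (Fin n) →ₗ[ℝ] EuclideanSpace ℝ (Fin n)) ≠ 0 := by
    rw [ne_eq, LinearMap.det_eq_zero_iff_ker_ne_bot, not_not]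
    exact LinearMap.ker_eq_bot.2 hA
  have hn : 0 < ‖A v‖ := norm_pos_iff.2 hv
  have hF := randersNorm_pos hp hv
  have hK := volume_real_randersNorm_ball_pos hp
  have hB : 0 < MeasureTheory.volume.real (Metric.ball (0 : EuclideanSpace ℝ (Fin n)) 1) :=
    ENNReal.toReal_pos (Metric.measure_ball_pos _ _ one_pos).ne'
      MeasureTheory.measure_ball_lt_top.ne
  have hvol : MeasureTheory.volume.real {v | L u v < 1} =
      |(LinearMap.det (A : EuclideanSpace ℝ (Fin n) →ₗ[ℝ] EuclideanSpace ℝ (Fin n)))⁻¹| *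
        MeasureTheory.volume.real {c | randersNorm p c < 1} := by
    have : {v | L u v < 1} = A ⁻¹' {c | randersNorm p c < 1} := by
      ext v
      simp [hL]
    rw [MeasureTheory.Measure.real, this,
      MeasureTheory.Measure.addHaar_preimage_continuousLinearMap _ hdet, ENNReal.toReal_mul,
      ENNReal.toReal_ofReal (abs_nonneg _)]
    rfl
  have hr : 0 < (randersNorm p (A v) / ‖A v‖) ^ (n + 1) := by positivity
  simp only [distortion, busemannHausdorff]
  rw [det_fundamentalTensor_of_frame hp hL hv, hvol, Real.sqrt_mul (sq_nonneg _),
    Real.sqrt_sq_eq_abs, abs_inv]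
  have habs := abs_pos.2 hdet
  set d := |LinearMap.det (A : EuclideanSpace ℝ (Fin n) →ₗ[ℝ] EuclideanSpace ℝ (Fin n))|
  set K := MeasureTheory.volume.real {c : EuclideanSpace ℝ (Fin n) | randersNorm p c < 1}
  set B := MeasureTheory.volume.real (Metric.ball (0 : EuclideanSpace ℝ (Fin n)) 1)
  have : d * √((randersNorm p (A v) / ‖A v‖) ^ (n + 1)) / (B / (d⁻¹ * K)) =
      √((randersNorm p (A v) / ‖A v‖) ^ (n + 1)) * (K / B) := by
    field_simp
  rw [this, Real.log_mul (Real.sqrt_pos.2 hr).ne' (by positivity), Real.log_sqrt hr.le,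
    Real.log_pow, Real.log_div hF.ne' hn.ne']
  push_cast
  ring

end Frame

end Finsler

/-! ### Geodesics and the rate of the distortion in a moving frame -/

namespace Finsler

open Filter Topology

section FrameRate

variable {n : ℕ} {L : EuclideanSpace ℝ (Fin n) → EuclideanSpace ℝ (Fin n) → ℝ}
  {p u v : EuclideanSpace ℝ (Fin n)} {U : Set (EuclideanSpace ℝ (Fin n))}
  {C : EuclideanSpace ℝ (Fin n) → EuclideanSpace ℝ (Fin n) →L[ℝ] EuclideanSpace ℝ (Fin n)}
  {C' : EuclideanSpace ℝ (Fin n) →L[ℝ]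
    EuclideanSpace ℝ (Fin n) →L[ℝ] EuclideanSpace ℝ (Fin n)}

theorem sum_smul_single (z : EuclideanSpace ℝ (Fin n)) :
    ∑ i, z i • EuclideanSpace.single i (1 : ℝ) = z := by
  have := (EuclideanSpace.basisFun (Fin n) ℝ).sum_repr z
  simpa using this

/-- The geodesic equation of a Randers function in a moving frame, which expresses the acceleration
`-2 G` through the frame components of the velocity. -/
theorem randersTensor_spray_of_frame (hU : U ∈ 𝓝 u)
    (hL : ∀ q ∈ U, ∀ w, L q w = randersNorm p (C q w)) (hC : HasFDerivAt C C' u)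
    (hinj : Function.Injective (C u)) (hp : ‖p‖ < 1) (hv : C u v ≠ 0)
    (z : EuclideanSpace ℝ (Fin n)) :
    randersTensor p (C u v) (C u z) (C u ((-2 : ℝ) • spray L u v) + C' v v) =
      randersNorm p (C u v) * randersNormDeriv p (C u v) (C' z v - C' v z) := by
  have huU := mem_of_mem_nhds hU
  set c := C u v with hc
  set g := fundamentalTensor L u v with hg
  have happly (w : EuclideanSpace ℝ (Fin n)) : HasFDerivAt (fun q => C q w) (C'.flip w) u := by
    simpa using hC.clm_apply (hasFDerivAt_const w u)
  let R : Fin n → ℝ := fun l =>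
    (∑ m, partialDeriv m (fun q => partialDeriv l (fun z => L q z ^ 2) v) u * v m)
      - partialDeriv l (fun q => L q v ^ 2) u
  -- `R` is the bracket in the spray formula. Differentiating through the frame splits it into a
  -- tensor term, from moving the velocity components, and a term antisymmetric in the two arguments
  -- of `C'`.
  have hR (l : Fin n) : R l =
      2 * randersTensor p c (C' v v) (C u (EuclideanSpace.single l 1)) +
        2 * randersNorm p c * randersNormDeriv p c
          (C' v (EuclideanSpace.single l 1) - C' (EuclideanSpace.single l 1) v) := by
    obtain ⟨D, hD, hD'⟩ := exists_hasFDerivAt_randersNormDeriv_comp p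
      (happly v) (happly (EuclideanSpace.single l 1)) hv
    have hne : ∀ᶠ q in 𝓝 u, C q v ≠ 0 := (happly v).continuousAt.eventually_ne hv
    have e1 : (fun q => partialDeriv l (fun z => L q z ^ 2) v) =ᶠ[𝓝 u] fun q =>
        2 * randersNorm p (C q v) * randersNormDeriv p (C q v)
          (C q (EuclideanSpace.single l 1)) := by
      filter_upwards [hU, hne] with q hq hq'
      exact partialDeriv_randersNorm_sq (hL q hq) hq' l
    have e2 : (fun q => L q v ^ 2) =ᶠ[𝓝 u] fun q => randersNorm p (C q v) ^ 2 := by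
      filter_upwards [hU] with q hq
      rw [hL q hq]
    have hsum : ∑ m, D (EuclideanSpace.single m 1) * v m = D v := by
      conv_rhs => rw [← sum_smul_single v]
      simp [mul_comm]
    simp only [R, partialDeriv, e2.fderiv_eq,
      (hasFDerivAt_randersNorm_sq_comp p (happly v) hv).fderiv]
    simp only [partialDeriv] at e1
    rw [e1.fderiv_eq, hD.fderiv, hsum, hD']
    simp only [ContinuousLinearMap.flip_apply, smul_apply, ContinuousLinearMap.comp_apply,
      smul_eq_mul, map_sub, ← hc]
    ring
  have hdet : IsUnit g.det := by
    have hA : LinearMap.det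
        (C u : EuclideanSpace ℝ (Fin n) →ₗ[ℝ] EuclideanSpace ℝ (Fin n)) ≠ 0 := by
      rw [ne_eq, LinearMap.det_eq_zero_iff_ker_ne_bot, not_not]
      exact LinearMap.ker_eq_bot.2 hinj
    have := norm_pos_iff.2 hv
    have := randersNorm_pos hp hv
    rw [hg, det_fundamentalTensor_of_frame hp (hL u huU) hv]
    exact (by positivity : _ ≠ (0 : ℝ)).isUnit
  -- The spray is `g⁻¹ R / 4`; multiplying by `g` removes the inverse.
  have hG (l : Fin n) : randersTensor p c (C u (EuclideanSpace.single l 1)) (C u (spray L u v)) =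
      1 / 4 * R l := by
    have h1 : (spray L u v).ofLp = g⁻¹.mulVec ((1 / 4 : ℝ) • R) := by
      ext i
      simp only [spray, R, Matrix.mulVec, dotProduct, hg, Pi.smul_apply, smul_eq_mul,
        Finset.mul_sum]
      exact Finset.sum_congr rfl fun _ _ => by ring
    have h2 : g.mulVec (spray L u v).ofLp l = 1 / 4 * R l := by
      rw [h1, Matrix.mulVec_mulVec, Matrix.mul_nonsing_inv _ hdet]
      simp
    rw [← h2]
    conv_lhs => rw [← sum_smul_single (spray L u v)]
    simp only [← randersForm_apply, map_sum, map_smul, smul_eq_mul]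
    simp only [Matrix.mulVec, dotProduct, hg, randersForm_apply,
      fundamentalTensor_apply_of_frame (hL u huU) hv, hc]
    exact Finset.sum_congr rfl fun i _ => mul_comm _ _
  have hl (l : Fin n) : randersTensor p c (C u (EuclideanSpace.single l 1))
      (C u ((-2 : ℝ) • spray L u v) + C' v v) = randersNorm p c * randersNormDeriv p c
        (C' (EuclideanSpace.single l 1) v - C' v (EuclideanSpace.single l 1)) := by
    have h1 := hG l
    rw [hR, randersTensor_comm p c (C' v v)] at h1
    simp only [← randersForm_apply, map_add, map_smul, smul_eq_mul, map_sub] at h1 ⊢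
    linear_combination (-2) * h1
  rw [← sum_smul_single z]
  generalize C u ((-2 : ℝ) • spray L u v) + C' v v = a at hl ⊢
  simp only [← randersForm_apply] at hl ⊢
  simp only [map_sum, map_smul, LinearMap.sum_apply, LinearMap.smul_apply, hl, smul_eq_mul,
    sum_apply, smul_apply, map_sub, ← Finset.sum_sub_distrib, Finset.mul_sum]
  exact Finset.sum_congr rfl fun i _ => by ring

/-- The rate of change of the distortion of a Randers function in a moving frame `C`, if the
associated one-form `p ∘ C` satisfies a closedness condition in the direction of `v`. -/
theorem distortionRate_of_frame (hU : U ∈ 𝓝 u)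
    (hL : ∀ q ∈ U, ∀ w, L q w = randersNorm p (C q w)) (hC : HasFDerivAt C C' u)
    (hinj : ∀ q ∈ U, Function.Injective (C q)) (hp : ‖p‖ < 1) (hv : C u v ≠ 0)
    {z : EuclideanSpace ℝ (Fin n)} (hz : C u z = p)
    (hclosed : inner ℝ p (C' z v - C' v z) = 0) :
    DifferentiableAt ℝ (distortion L) (u, v) ∧
      distortionRate L u v =
        (n + 1) / 2 * (inner ℝ (C u v) (C' z v - C' v z) / randersNorm p (C u v)) := by
  have huU := mem_of_mem_nhds hU
  have hn : 0 < ‖C u v‖ := norm_pos_iff.2 hv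
  have hF := randersNorm_pos hp hv
  have hq : HasFDerivAt (fun q : EuclideanSpace ℝ (Fin n) × EuclideanSpace ℝ (Fin n) => C q.1 q.2)
      _ (u, v) :=
    (hC.comp (u, v) (hasFDerivAt_fst (𝕜 := ℝ) (p := (u, v)))).clm_apply hasFDerivAt_snd
  have hq1 := (hasFDerivAt_randersNorm p hv).comp (u, v) hq
  have hq2 := (hasFDerivAt_norm_of_ne hv).comp (u, v) hq
  have h1 := (hq1.log hF.ne').sub (hq2.log hn.ne')
  have h2 := (h1.const_mul ((n + 1 : ℝ) / 2)).add_const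
    (Real.log (MeasureTheory.volume.real {c : EuclideanSpace ℝ (Fin n) | randersNorm p c < 1} /
          MeasureTheory.volume.real (Metric.ball (0 : EuclideanSpace ℝ (Fin n)) 1)))
  have h3 : HasFDerivAt (distortion L) _ (u, v) := h2.congr_of_eventuallyEq (by
    filter_upwards [continuousAt_fst.preimage_mem_nhds hU, hq.continuousAt.eventually_ne hv]
      with q hq1 hq2
    exact distortion_of_frame (hinj q.1 hq1) hp (hL q.1 hq1) hq2)
  refine ⟨h3.differentiableAt, ?_⟩
  have hEL := randersTensor_spray_of_frame hU hL hC (hinj u huU) hp hv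
  rw [distortionRate, h3.fderiv]
  simp only [Function.comp_apply, smul_apply, sub_apply, ContinuousLinearMap.comp_apply, add_apply,
    ContinuousLinearMap.flip_apply, ContinuousLinearMap.coe_fst', ContinuousLinearMap.coe_snd',
    smul_eq_mul, innerSL_apply_apply]
  set a := C u ((-2 : ℝ) • spray L u v) + C' v v with ha
  set c := C u v with hc
  set k := C' z v - C' v z with hk
  -- Testing against the velocity makes the right side vanish: the derivative of `F` in the
  -- direction of the frame acceleration `a` is zero.
  have t1 := hEL v
  rw [sub_self, map_zero, mul_zero, randersTensor_comm, ← hc, randersTensor_self p hv] at t1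
  have t2 : randersNormDeriv p c a = 0 := (mul_eq_zero.1 t1).resolve_left hF.ne'
  -- Testing against the direction with frame components `p`; closedness leaves only `⟨c, k⟩/‖c‖` on
  -- the right.
  have t3 := hEL z
  rw [hz, ← hk, randersTensor, t2, mul_zero, zero_add, randersNormDeriv_apply, hclosed,
    add_zero] at t3
  have t4 := mul_left_cancel₀ hF.ne' t3
  rw [t2]
  rw [randersNormDeriv_apply] at t2
  -- Eliminating `⟨p, a⟩` gives `⟨c, a⟩/‖c‖² = -⟨c, k⟩/F`, the rate of `log ‖c‖`.
  have t5 : inner ℝ p a = - (‖c‖⁻¹ * inner ℝ c a) := by linarith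
  rw [t5, real_inner_comm p c] at t4
  rw [randersNorm] at hF ⊢
  field_simp at t4 ⊢
  linear_combination t4

end FrameRate

end Finsler

/-! ### Left invariant frames in a chart -/

namespace Finsler

open Filter Topology VectorField

theorem mlieBracket_eq_lieBracket {E : Type*} [NormedAddCommGroup E] [NormedSpace ℝ E]
    (V W : (u : E) → TangentSpace 𝓘(ℝ, E) u) :
    mlieBracket 𝓘(ℝ, E) V W = lieBracket ℝ V W := by
  rw [← mlieBracketWithin_univ, mlieBracketWithin_eq_lieBracketWithin]
  exact lieBracketWithin_univ

section Chart

variable {n : ℕ} {G : Type*} [TopologicalSpace G]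
    [ChartedSpace (EuclideanSpace ℝ (Fin n)) G]
    {φ : OpenPartialHomeomorph G (EuclideanSpace ℝ (Fin n))}

theorem mdifferentiable_of_mem_maximalAtlas
    (hφ : φ ∈ IsManifold.maximalAtlas (𝓡 n) ∞ G) :
    φ.MDifferentiable (𝓡 n) (𝓡 n) :=
  ⟨(contMDiffOn_of_mem_maximalAtlas hφ).mdifferentiableOn (by simp),
    (contMDiffOn_symm_of_mem_maximalAtlas hφ).mdifferentiableOn (by simp)⟩

theorem isInvertible_mfderiv_symm
    (hφ : φ ∈ IsManifold.maximalAtlas (𝓡 n) ∞ G)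
    {u : EuclideanSpace ℝ (Fin n)} (hu : u ∈ φ.target) :
    (mfderiv (𝓡 n) (𝓡 n)
      φ.symm u).IsInvertible :=
  ⟨(mdifferentiable_of_mem_maximalAtlas hφ).symm.mfderiv hu, rfl⟩

variable [Group G]

/-- The expression in the chart `φ` of the left invariant vector field with value `W` at the
identity. -/
def chartField (φ : OpenPartialHomeomorph G (EuclideanSpace ℝ (Fin n)))
    (W : GroupLieAlgebra (𝓡 n) G) (u : EuclideanSpace ℝ (Fin n)) :
    EuclideanSpace ℝ (Fin n) :=
  mpullback (𝓡 n) (𝓡 n) φ.symm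
    (mulInvariantVectorField W) u

theorem chartField_add (φ : OpenPartialHomeomorph G (EuclideanSpace ℝ (Fin n)))
    (V W : GroupLieAlgebra (𝓡 n) G) (u : EuclideanSpace ℝ (Fin n)) :
    chartField φ (V + W) u = chartField φ V u + chartField φ W u := by
  rw [chartField, mulInvariantVectorField_add, mpullback_add_apply]
  rfl

theorem chartField_smul (φ : OpenPartialHomeomorph G (EuclideanSpace ℝ (Fin n))) (r : ℝ)
    (W : GroupLieAlgebra (𝓡 n) G) (u : EuclideanSpace ℝ (Fin n)) :
    chartField φ (r • W) u = r • chartField φ W u := by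
  rw [chartField, mulInvariantVectorField_smul, mpullback_const_smul_apply]
  rfl

theorem mulInvariantVectorField_one (W : GroupLieAlgebra (𝓡 n) G) :
    mulInvariantVectorField W 1 = W := by
  have h : (fun g : G => 1 * g) = id := by
    ext g
    simp
  simp only [mulInvariantVectorField]
  rw [h]
  rw [mfderiv_id]
  rfl

/-- The frame of the left invariant vector fields with values `Φ c` at the identity, in the chart
`φ`. -/
def chartFrame (φ : OpenPartialHomeomorph G (EuclideanSpace ℝ (Fin n)))
    (Φ : EuclideanSpace ℝ (Fin n) →ₗ[ℝ] GroupLieAlgebra (𝓡 n) G)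
    (u : EuclideanSpace ℝ (Fin n)) : EuclideanSpace ℝ (Fin n) →L[ℝ] EuclideanSpace ℝ (Fin n) :=
  LinearMap.toContinuousLinearMap
    { toFun c := chartField φ (Φ c) u
      map_add' c d := by rw [map_add, chartField_add]
      map_smul' r c := by rw [map_smul, chartField_smul]; rfl }

theorem chartFrame_apply (φ : OpenPartialHomeomorph G (EuclideanSpace ℝ (Fin n)))
    (Φ : EuclideanSpace ℝ (Fin n) →ₗ[ℝ] GroupLieAlgebra (𝓡 n) G)
    (u c : EuclideanSpace ℝ (Fin n)) : chartFrame φ Φ u c = chartField φ (Φ c) u := rfl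

theorem mfderiv_symm_chartField
    (hφ : φ ∈ IsManifold.maximalAtlas (𝓡 n) ∞ G)
    {u : EuclideanSpace ℝ (Fin n)} (hu : u ∈ φ.target)
    (W : GroupLieAlgebra (𝓡 n) G) :
    mfderiv (𝓡 n) (𝓡 n) φ.symm u
      (chartField φ W u) = mulInvariantVectorField W (φ.symm u) :=
  (isInvertible_mfderiv_symm hφ hu).self_apply_inverse _

theorem mfderiv_mulInvariantVectorField
    (hφ : φ ∈ IsManifold.maximalAtlas (𝓡 n) ∞ G)
    {x : G} (hx : x ∈ φ.source) (W : GroupLieAlgebra (𝓡 n) G) :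
    mfderiv (𝓡 n) (𝓡 n) φ x
      (mulInvariantVectorField W x) = chartField φ W (φ x) := by
  have h := (mdifferentiable_of_mem_maximalAtlas hφ).comp_symm_deriv (φ.map_source hx)
  have h1 := mfderiv_symm_chartField hφ (φ.map_source hx) W
  have h2 := DFunLike.congr_fun h (chartField φ W (φ x))
  -- The tangent space depends on the point and `φ.symm (φ x) = x` is not definitional, so the
  -- equality is proved for a variable `z` that can be substituted.
  have key : ∀ z : G, z = x → (mfderiv (𝓡 n) (𝓡 n) φ z (mulInvariantVectorField W z) :
      EuclideanSpace ℝ (Fin n)) = mfderiv (𝓡 n) (𝓡 n) φ x (mulInvariantVectorField W x) := by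
    rintro z rfl
    rfl
  refine (key _ (φ.left_inv hx)).symm.trans (Eq.trans ?_ h2)
  exact (congrArg (mfderiv (𝓡 n) (𝓡 n) φ (φ.symm (φ x))) h1).symm

variable [LieGroup (𝓡 n) ∞ G]

instance lieGroup_minSmoothness :
    LieGroup (𝓡 n) (minSmoothness ℝ 3) G := by
  rw [minSmoothness_of_isRCLikeNormedField]
  infer_instance

theorem differentiableAt_chartField
    (hφ : φ ∈ IsManifold.maximalAtlas (𝓡 n) ∞ G)
    {u : EuclideanSpace ℝ (Fin n)} (hu : u ∈ φ.target)
    (W : GroupLieAlgebra (𝓡 n) G) :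
    DifferentiableAt ℝ (chartField φ W) u := by
  have h := ContMDiffAt.mpullback_vectorField_preimage (m := 1) (n := 2)
    ((contMDiffAt_mulInvariantVectorField W (g := φ.symm u)).of_le
      (by rw [minSmoothness_of_isRCLikeNormedField]; norm_num))
    ((contMDiffAt_symm_of_mem_maximalAtlas hφ hu).of_le (by exact ENat.LEInfty.out))
    (isInvertible_mfderiv_symm hφ hu) (by norm_num)
  exact (contMDiffAt_vectorSpace_iff_contDiffAt.1 h).differentiableAt (by simp)

/-- Pullback by the chart commutes with brackets, and the bracket of left invariant fields is left
invariant. -/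
theorem lieBracket_chartField
    (hφ : φ ∈ IsManifold.maximalAtlas (𝓡 n) ∞ G)
    {u : EuclideanSpace ℝ (Fin n)} (hu : u ∈ φ.target)
    (V W : GroupLieAlgebra (𝓡 n) G) :
    lieBracket ℝ (chartField φ V) (chartField φ W) u = chartField φ ⁅V, W⁆ u := by
  have h := mpullback_mlieBracket (n := ∞)
    (mdifferentiableAt_mulInvariantVectorField V (g := φ.symm u))
    (mdifferentiableAt_mulInvariantVectorField W (g := φ.symm u))
    (contMDiffAt_symm_of_mem_maximalAtlas hφ hu)
    (by rw [minSmoothness_of_isRCLikeNormedField]; exact ENat.LEInfty.out)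
  have e : mlieBracket (𝓡 n) (chartField φ V) (chartField φ W) =
      lieBracket ℝ (chartField φ V) (chartField φ W) := by
    exact mlieBracket_eq_lieBracket _ _
  rw [← e, chartField, GroupLieAlgebra.bracket_def, mulInvariantVector_mlieBracket]
  exact h.symm

theorem inner_mulInvariantVectorField {a : RiemannianMetricOn n G} (ha : IsLeftInvariant a)
    (V W : GroupLieAlgebra (𝓡 n) G) (x : G) :
    a.inner x (mulInvariantVectorField V x) (mulInvariantVectorField W x) = a.inner 1 V W := by
  have key : ∀ z : G, z = x → ∀ v w : EuclideanSpace ℝ (Fin n),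
      a.inner z v w = a.inner x v w := by
    rintro z rfl v w
    rfl
  exact (key (x * 1) (mul_one x) _ _).symm.trans (ha x 1 V W)

theorem differentiableAt_chartFrame
    (hφ : φ ∈ IsManifold.maximalAtlas (𝓡 n) ∞ G)
    {u : EuclideanSpace ℝ (Fin n)} (hu : u ∈ φ.target)
    (Φ : EuclideanSpace ℝ (Fin n) →ₗ[ℝ] GroupLieAlgebra (𝓡 n) G) :
    DifferentiableAt ℝ (chartFrame φ Φ) u := by
  have h : chartFrame φ Φ = fun q => ∑ i, (EuclideanSpace.proj (𝕜 := ℝ) i).smulRight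
      (chartField φ (Φ (EuclideanSpace.single i 1)) q) := by
    ext1 q
    ext1 c
    conv_lhs => rw [← sum_smul_single c]
    simp [chartFrame_apply]
  rw [h]
  refine DifferentiableAt.fun_sum fun i _ => ?_
  exact ((ContinuousLinearMap.smulRightL ℝ _ _ (EuclideanSpace.proj i)).differentiableAt).comp u
    (differentiableAt_chartField hφ hu _)

variable {a : RiemannianMetricOn n G}
  {Φ : EuclideanSpace ℝ (Fin n) →ₗ[ℝ] GroupLieAlgebra (𝓡 n) G}

/-- By left invariance the frame stays orthonormal at every point, hence is injective, and the
dimensions agree. -/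
theorem isInvertible_chartFrame (hΦ : ∀ c d, a.inner 1 (Φ c) (Φ d) = inner ℝ c d)
    (ha : IsLeftInvariant a) (hφ : φ ∈ IsManifold.maximalAtlas (𝓡 n) ∞ G)
    {u : EuclideanSpace ℝ (Fin n)} (hu : u ∈ φ.target) :
    (chartFrame φ Φ u).IsInvertible := by
  have hinj : Function.Injective (chartFrame φ Φ u) := by
    refine (injective_iff_map_eq_zero _).2 fun c hc => ?_
    have h0 : mulInvariantVectorField (Φ c) (φ.symm u) = 0 := by
      rw [← mfderiv_symm_chartField hφ hu, ← chartFrame_apply, hc]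
      exact map_zero _
    have h1 := inner_mulInvariantVectorField ha (Φ c) (Φ c) (φ.symm u)
    rw [h0, hΦ, map_zero] at h1
    exact inner_self_eq_zero.1 h1.symm
  exact ⟨(LinearEquiv.ofInjectiveEndo (chartFrame φ Φ u).toLinearMap
    hinj).toContinuousLinearEquiv, rfl⟩

/-- The right side does not involve `u`: this is what makes the moving frame results applicable. -/
theorem inChart_randers (hΦ : ∀ c d, a.inner 1 (Φ c) (Φ d) = inner ℝ c d)
    (ha : IsLeftInvariant a) (hφ : φ ∈ IsManifold.maximalAtlas (𝓡 n) ∞ G)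
    {u : EuclideanSpace ℝ (Fin n)} (hu : u ∈ φ.target) (p c : EuclideanSpace ℝ (Fin n)) :
    inChart (randers a (Φ p)) φ u (chartFrame φ Φ u c) = randersNorm p c := by
  rw [inChart, randers, chartFrame_apply, mfderiv_symm_chartField hφ hu,
    inner_mulInvariantVectorField ha, inner_mulInvariantVectorField ha, hΦ, hΦ,
    real_inner_self_eq_norm_sq, Real.sqrt_sq (norm_nonneg _), randersNorm]

/-- The S-curvature of a left invariant Randers metric on the left invariant vector field `Φ y`,
where `Φ` is an isometry from Euclidean space to the Lie algebra, if the bracket of `Φ y` and the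
vector field `Φ p` defining the metric is orthogonal to `Φ p`. -/
theorem hasSCurvature_randers_of_isometry (hΦ : ∀ c d, a.inner 1 (Φ c) (Φ d) = inner ℝ c d)
    (ha : IsLeftInvariant a) {p y k : EuclideanSpace ℝ (Fin n)} (hp : ‖p‖ < 1) (hy : y ≠ 0)
    (hk : ⁅Φ y, Φ p⁆ = Φ k) (horth : inner ℝ p k = 0) (x : G) :
    HasSCurvature (randers a (Φ p)) x (mulInvariantVectorField (Φ y) x)
      ((n + 1) / 2 * (inner ℝ y k / randersNorm p y)) := by
  intro φ hφ hx
  have hu : φ x ∈ φ.target := φ.map_source hx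
  have hinv {q : EuclideanSpace ℝ (Fin n)} (hq : q ∈ φ.target) :=
    isInvertible_chartFrame hΦ ha hφ hq
  -- The dual coframe, sending a coordinate velocity to its components in the left invariant frame.
  let C : EuclideanSpace ℝ (Fin n) → EuclideanSpace ℝ (Fin n) →L[ℝ] EuclideanSpace ℝ (Fin n) :=
    fun q => (chartFrame φ Φ q).inverse
  have hCB {q : EuclideanSpace ℝ (Fin n)} (hq : q ∈ φ.target) (c : EuclideanSpace ℝ (Fin n)) :
      C q (chartField φ (Φ c) q) = c := (hinv hq).inverse_apply_self c
  have hC : DifferentiableAt ℝ C (φ x) :=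
    ((hinv hu).contDiffAt_map_inverse.differentiableAt one_ne_zero).comp (φ x)
      (differentiableAt_chartFrame hφ hu Φ)
  -- Product rule applied to the constant function `q ↦ C q (chartField φ (Φ c) q) = c`.
  have hMC (c w : EuclideanSpace ℝ (Fin n)) :
      fderiv ℝ C (φ x) w (chartField φ (Φ c) (φ x)) =
        - C (φ x) (fderiv ℝ (chartField φ (Φ c)) (φ x) w) := by
    have h1 := hC.hasFDerivAt.clm_apply (differentiableAt_chartField hφ hu (Φ c)).hasFDerivAt
    have h2 : (fun q => C q (chartField φ (Φ c) q)) =ᶠ[𝓝 (φ x)] fun _ => c := by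
      filter_upwards [φ.open_target.mem_nhds hu] with q hq
      exact hCB hq c
    have h3 := (h1.congr_of_eventuallyEq h2.symm).unique (hasFDerivAt_const c (φ x))
    have h4 := DFunLike.congr_fun h3 w
    simp only [add_apply, ContinuousLinearMap.comp_apply, ContinuousLinearMap.flip_apply] at h4
    exact eq_neg_of_add_eq_zero_right h4
  -- The Maurer-Cartan equation: the antisymmetrised derivative of the coframe is the Lie algebra
  -- bracket.
  have hκ : fderiv ℝ C (φ x) (chartField φ (Φ p) (φ x)) (chartField φ (Φ y) (φ x)) -
      fderiv ℝ C (φ x) (chartField φ (Φ y) (φ x)) (chartField φ (Φ p) (φ x)) = k := by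
    rw [hMC, hMC, ← hCB hu k, ← hk, ← lieBracket_chartField hφ hu, lieBracket_eq, map_sub]
    abel
  have hmain := distortionRate_of_frame (L := inChart (randers a (Φ p)) φ) (p := p)
    (v := chartField φ (Φ y) (φ x)) (z := chartField φ (Φ p) (φ x)) (C := C)
    (φ.open_target.mem_nhds hu)
    (fun q hq w => by
      have hw : chartFrame φ Φ q (C q w) = w := (hinv hq).self_apply_inverse w
      conv_lhs => rw [← hw]
      exact inChart_randers hΦ ha hφ hq p _)
    hC.hasFDerivAt
    (fun q hq => by
      refine Function.LeftInverse.injective (g := chartFrame φ Φ q) fun w => ?_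
      exact (hinv hq).self_apply_inverse w)
    hp (by rwa [hCB hu]) (hCB hu p) (by rw [hκ, horth])
  rw [hκ, hCB hu] at hmain
  have hv := mfderiv_mulInvariantVectorField hφ hx (Φ y)
  intro v
  have hv' : v = chartField φ (Φ y) (φ x) := hv
  rw [hv']
  exact hmain

/-- The S-curvature of a left invariant Randers metric defined by a left invariant vector field `X`
on a left invariant vector field `Y` with `[Y, X]` orthogonal to `X`. -/
theorem hasSCurvature_randers (ha : IsLeftInvariant a) {E : Fin n → GroupLieAlgebra (𝓡 n) G}
    (hE : ∀ i j, a.inner 1 (E i) (E j) = if i = j then 1 else 0)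
    {X Y : GroupLieAlgebra (𝓡 n) G} (hX : a.inner 1 X X < 1) (hY : Y ≠ 0)
    (horth : a.inner 1 X ⁅Y, X⁆ = 0) (x : G) :
    HasSCurvature (randers a X) x (mulInvariantVectorField Y x)
      ((n + 1) / 2 * (a.inner 1 Y ⁅Y, X⁆ / randers a X 1 Y)) := by
  let Φ : EuclideanSpace ℝ (Fin n) →ₗ[ℝ] GroupLieAlgebra (𝓡 n) G :=
    { toFun c := ∑ i, c i • E i
      map_add' c d := by simp [add_smul, Finset.sum_add_distrib]
      map_smul' r c := by simp [mul_smul, Finset.smul_sum] }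
  have hΦ : ∀ c d, a.inner 1 (Φ c) (Φ d) = inner ℝ c d := by
    intro c d
    change a.inner 1 (∑ i, c i • E i) (∑ i, d i • E i) = _
    simp [hE, PiLp.inner_apply, mul_comm]
  have hsurj : Function.Surjective Φ := by
    have hinj : Function.Injective Φ := by
      refine (injective_iff_map_eq_zero _).2 fun c hc => ?_
      have h1 := hΦ c c
      rw [hc, map_zero] at h1
      exact inner_self_eq_zero.1 h1.symm
    exact LinearMap.surjective_of_injective (V := EuclideanSpace ℝ (Fin n)) hinj
  obtain ⟨p, rfl⟩ := hsurj X
  obtain ⟨y, rfl⟩ := hsurj Y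
  obtain ⟨k, hk⟩ := hsurj ⁅Φ y, Φ p⁆
  rw [hΦ, real_inner_self_eq_norm_sq] at hX
  rw [← hk, hΦ] at horth
  have hy : y ≠ 0 := by
    rintro rfl
    exact hY (map_zero Φ)
  have hF : randers a (Φ p) 1 (Φ y) = randersNorm p y := by
    rw [randers, mulInvariantVectorField_one, hΦ, hΦ, real_inner_self_eq_norm_sq,
      Real.sqrt_sq (norm_nonneg _), randersNorm]
  rw [← hk, hΦ, hF]
  exact hasSCurvature_randers_of_isometry hΦ ha ((sq_lt_one_iff₀ (norm_nonneg p)).1 hX) hy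
    hk.symm horth x

end Chart

end Finsler

end

/-! ### The four nilpotent Lie algebras -/

theorem mainTheorem12 {G : Type*} [TopologicalSpace G]
    [ChartedSpace (EuclideanSpace ℝ (Fin 5)) G] [Group G]
    [LieGroup 𝓘(ℝ, EuclideanSpace ℝ (Fin 5)) ∞ G]
    (ã : Finsler.RiemannianMetricOn 5 G) (hã : Finsler.IsLeftInvariant ã)
    (E : Fin 5 → GroupLieAlgebra 𝓘(ℝ, EuclideanSpace ℝ (Fin 5)) G)
    (hE : ∀ i j, ã.inner 1 (E i) (E j) = if i = j then 1 else 0)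
    (y₁ y₂ y₃ y₄ y₅ : ℝ)
    (Y : GroupLieAlgebra 𝓘(ℝ, EuclideanSpace ℝ (Fin 5)) G)
    (hY : Y = y₁ • E 0 + y₂ • E 1 + y₃ • E 2 + y₄ • E 3 + y₅ • E 4) (hY0 : Y ≠ 0) :
    (∀ a b c d f g : ℝ, IsL57 E a b c d f g →
      ∀ (l₁ l₂ : ℝ) (X : GroupLieAlgebra 𝓘(ℝ, EuclideanSpace ℝ (Fin 5)) G),
        X = l₁ • E 0 + l₂ • E 1 → ã.inner 1 X X < 1 →
        ∀ x : G, Finsler.HasSCurvature (Finsler.randers ã X) x (mulInvariantVectorField Y x)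
          (3 * (((y₁ * l₂ - y₂ * l₁) * (a * y₃ + b * y₄ + c * y₅)
            - l₁ * y₃ * (d * y₄ + f * y₅) - l₁ * g * y₄ * y₅) / Finsler.randers ã X 1 Y))) ∧
    (∀ a b c d f g h : ℝ, IsL56 E a b c d f g h →
      ∀ (l₁ l₂ : ℝ) (X : GroupLieAlgebra 𝓘(ℝ, EuclideanSpace ℝ (Fin 5)) G),
        X = l₁ • E 0 + l₂ • E 1 → ã.inner 1 X X < 1 →
        ∀ x : G, Finsler.HasSCurvature (Finsler.randers ã X) x (mulInvariantVectorField Y x)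
          (3 * (((y₁ * l₂ - y₂ * l₁) * (a * y₃ + b * y₄ + c * y₅)
            - l₁ * y₃ * (d * y₄ + f * y₅) - y₅ * (h * l₂ * y₃ + g * l₁ * y₄))
              / Finsler.randers ã X 1 Y))) ∧
    (∀ a b c d e : ℝ, IsL55 E a b c d e →
      ∀ (l₁ l₂ l₃ : ℝ) (X : GroupLieAlgebra 𝓘(ℝ, EuclideanSpace ℝ (Fin 5)) G),
        X = l₁ • E 0 + l₂ • E 1 + l₃ • E 2 → ã.inner 1 X X < 1 →
        ∀ x : G, Finsler.HasSCurvature (Finsler.randers ã X) x (mulInvariantVectorField Y x)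
          (3 * (((y₁ * l₂ - y₂ * l₁) * (a * y₄ + b * y₅) + y₅ * l₃ * (c * y₁ + e * y₂)
            - y₅ * l₁ * (c * y₃ + d * y₄) - e * l₂ * y₃ * y₅) / Finsler.randers ã X 1 Y))) ∧
    (∀ k l m p q : ℝ, IsL59 E k l m p q →
      ∀ (l₁ l₂ : ℝ) (X : GroupLieAlgebra 𝓘(ℝ, EuclideanSpace ℝ (Fin 5)) G),
        X = l₁ • E 0 + l₂ • E 1 → ã.inner 1 X X < 1 →
        ∀ x : G, Finsler.HasSCurvature (Finsler.randers ã X) x (mulInvariantVectorField Y x)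
          (3 * (((y₁ * l₂ - y₂ * l₁) * (k * y₃ + l * y₄ + m * y₅)
            - y₃ * (p * l₁ * y₄ + q * l₂ * y₅)) / Finsler.randers ã X 1 Y))) := by
  -- Each case reduces to two inner products: `⟨X, [Y, X]⟩ = 0` and the value of `⟨Y, [Y, X]⟩`.
  have hS : ∀ (X : GroupLieAlgebra (𝓡 5) G) (s : ℝ), ã.inner 1 X X < 1 →
      ã.inner 1 X ⁅Y, X⁆ = 0 → ã.inner 1 Y ⁅Y, X⁆ = s → ∀ x : G,
      Finsler.HasSCurvature (Finsler.randers ã X) x (mulInvariantVectorField Y x)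
        (3 * (s / Finsler.randers ã X 1 Y)) := by
    rintro X s hX horth rfl x
    convert Finsler.hasSCurvature_randers hã hE hX hY0 horth x using 1
    norm_num
  have skew : ∀ {i j : Fin 5} {W : GroupLieAlgebra (𝓡 5) G},
      ⁅E i, E j⁆ = W → ⁅E j, E i⁆ = - W := by
    rintro i j _ rfl
    exact (lie_skew _ _).symm
  refine ⟨?_, ?_, ?_, ?_⟩
  -- All brackets lie in the span of `E 2`, `E 3`, `E 4`, orthogonal to `X`. The relations are
  -- mostly needed reversed, since `X` is the second argument.
  · intro a b c d f g h l₁ l₂ X hXe hX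
    refine hS X _ hX ?_ ?_ <;> subst hXe hY <;>
    simp [h.bracket12, skew h.bracket12, skew h.bracket13,
      skew h.bracket14, skew h.bracket15, skew h.bracket23, skew h.bracket24, skew h.bracket25, hE]
    ring
  · intro a b c d f g e h l₁ l₂ X hXe hX
    refine hS X _ hX ?_ ?_ <;> subst hXe hY <;>
    simp [h.bracket12, skew h.bracket12, skew h.bracket13,
      skew h.bracket14, skew h.bracket15, skew h.bracket23, skew h.bracket24, skew h.bracket25, hE]
    ring
  -- Here brackets lie in the span of `E 3`, `E 4`, so `X` may have an `E 2` component, which brings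
  -- in further relations.
  · intro a b c d e h l₁ l₂ l₃ X hXe hX
    refine hS X _ hX ?_ ?_ <;> subst hXe hY <;>
    simp [h.bracket12, h.bracket13, h.bracket23, skew h.bracket12, skew h.bracket13,
      skew h.bracket14, skew h.bracket15, skew h.bracket23, skew h.bracket24, skew h.bracket25,
      skew h.bracket34, skew h.bracket35, hE]
    ring
  · intro k l m p q h l₁ l₂ X hXe hX
    refine hS X _ hX ?_ ?_ <;> subst hXe hY <;>
    simp [h.bracket12, skew h.bracket12, skew h.bracket13,
      skew h.bracket14, skew h.bracket15, skew h.bracket23, skew h.bracket24, skew h.bracket25, hE]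
    ring
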